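/- Call a linear map $\varphi : M_d(\mathbb{C}) \to M_d(\mathbb{C})$ CPTP if it is completely positive and trace preserving. For a set $\mathcal{F}$ of such maps, let $\mathcal{F}^*$ be the semigroup that it generates under composition, that is, the set of all compositions of finitely many (at least one) elements of $\mathcal{F}$. The membership problem for semigroups of CPTP maps is the following decision problem. An input consists of a dimension $d \geq 1$, a finite set $\mathcal{F}$ of CPTP maps on $M_d(\mathbb{C})$ and a CPTP map $\psi$ on $M_d(\mathbb{C})$; each map is given by its $d^2 \times d^2$ matrix in the basis of matrix units, with entries in $\mathbb{Q}(i)$. The question is whether $\psi \in \mathcal{F}^*$. **Theorem.** The membership problem for semigroups of CPTP maps is undecidable: there is no algorithm that, for every such input $(d, \mathcal{F}, \psi)$, halts and answers correctly whether $\psi \in \mathcal{F}^*$. This remains true if the algorithm only has to treat the inputs in which $d = 4$ and $\mathcal{F}$ contains the identity map. -/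

import Mathlib

namespace CPTPMembership

/-! ### Completely positive trace preserving maps -/

section Channels

open scoped CStarAlgebra Matrix.Norms.L2Operator MatrixOrder

/-- A linear map on the complex `d × d` matrices is CPTP if it is completely positive (it underlies
one of Mathlib's completely positive maps of the C⋆-algebra of `d × d` matrices, in which `0 ≤ M`
means that `M` is positive semidefinite) and preserves the trace. -/
def IsCPTP {d : ℕ} (φ : Module.End ℂ (Matrix (Fin d) (Fin d) ℂ)) : Prop :=
  (∃ Φ : Matrix (Fin d) (Fin d) ℂ →CP Matrix (Fin d) (Fin d) ℂ, Φ.toLinearMap = φ) ∧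
    ∀ ρ : Matrix (Fin d) (Fin d) ℂ, (φ ρ).trace = ρ.trace

end Channels

/-! ### Finite descriptions of channels -/

/-- A code `(a, b, c)` for the Gaussian rational `(a + b i) / (c + 1)`. Every element of `ℚ(i)` has
such a code. -/
abbrev GaussCode : Type := ℤ × ℤ × ℕ

/-- The complex number with a given code. -/
noncomputable def GaussCode.toComplex (z : GaussCode) : ℂ :=
  ((z.1 : ℂ) + (z.2.1 : ℂ) * Complex.I) / ((z.2.2 : ℂ) + 1)

/-- A code for a linear map on the `d × d` matrices: the list of the `d ^ 4` entries of the matrix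
that represents it in the basis of matrix units. -/
abbrev MapCode : Type := List GaussCode

/-- The coefficient at position `n` (and `0` past the end of the list). -/
noncomputable def MapCode.coeff (c : MapCode) (n : ℕ) : ℂ :=
  (c.getD n (0, 0, 0)).toComplex

/-- The linear map with code `c`: the image of `ρ` has the entries
`(φ ρ) k l = ∑ i j, φ_{(k,l),(i,j)} * ρ i j`, where `φ_{(k,l),(i,j)}` stands at position
`((k * d + l) * d + i) * d + j` of the list. -/
noncomputable def MapCode.toMap (d : ℕ) (c : MapCode) :
    Module.End ℂ (Matrix (Fin d) (Fin d) ℂ) where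
  toFun ρ := Matrix.of fun k l : Fin d =>
    ∑ i : Fin d, ∑ j : Fin d,
      c.coeff ((((k : ℕ) * d + (l : ℕ)) * d + (i : ℕ)) * d + (j : ℕ)) * ρ i j
  map_add' ρ σ := by
    ext k l
    simp [mul_add, Finset.sum_add_distrib]
  map_smul' r ρ := by
    ext k l
    simp only [Matrix.of_apply, Matrix.smul_apply, smul_eq_mul, RingHom.id_apply, Finset.mul_sum]
    exact Finset.sum_congr rfl fun i _ => Finset.sum_congr rfl fun j _ => by ring

/-- `c` is a code for a CPTP map on the `d × d` matrices. -/
def MapCode.Valid (d : ℕ) (c : MapCode) : Prop :=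
  c.length = d ^ 4 ∧ IsCPTP (c.toMap d)

/-! ### The membership problem -/

/-- An input `(d, F, ψ)` of the membership problem: a dimension, a finite list of codes of
generators and the code of a further map. -/
abbrev MembershipInput : Type := ℕ × List MapCode × MapCode

/-- The dimension. -/
def MembershipInput.dim (x : MembershipInput) : ℕ := x.1

/-- The finite set of maps whose codes are listed in the input. -/
def MembershipInput.generators (x : MembershipInput) :
    Set (Module.End ℂ (Matrix (Fin x.dim) (Fin x.dim) ℂ)) :=
  {φ | ∃ c ∈ x.2.1, MapCode.toMap x.dim c = φ}

/-- The map about which the question is asked. -/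
noncomputable def MembershipInput.target (x : MembershipInput) :
    Module.End ℂ (Matrix (Fin x.dim) (Fin x.dim) ℂ) :=
  MapCode.toMap x.dim x.2.2

/-- The input describes CPTP maps on a nonzero finite-dimensional space. -/
def MembershipInput.Valid (x : MembershipInput) : Prop :=
  0 < x.dim ∧ (∀ c ∈ x.2.1, MapCode.Valid x.dim c) ∧ MapCode.Valid x.dim x.2.2

/-- The question: is the target a composition of finitely many (at least one) generators? The
product of `Module.End` is the composition of maps. -/
def MembershipInput.IsYes (x : MembershipInput) : Prop :=
  x.target ∈ Subsemigroup.closure x.generators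

/-- The membership problem is decidable on a class `S` of inputs if some algorithm (a partial
recursive function) halts with the correct answer on every input in `S`; nothing is asked of it on
other inputs. -/
def DecidableOn (S : Set MembershipInput) : Prop :=
  ∃ A : MembershipInput →. Bool, Partrec A ∧
    ∀ x ∈ S, ∃ b : Bool, A x = Part.some b ∧ (b = true ↔ x.IsYes)

end CPTPMembership

/-!
The halting problem is reduced to the membership problem, with the help of channels that are
*classical*: `classicalMap P` measures in the standard basis and applies a stochastic matrix `P` to
the resulting probability vector. Composition of such channels is multiplication of the matrices,
so apart from the identity map the question concerns a semigroup of stochastic `4 × 4` matrices.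

**Dominoes.** A configuration of a Turing machine, with tape `l` left of the head, state `q` and
tape `r` from the head on, is written as the circular word `# l q r` and kept in a queue. A domino
`(v, u)` reads `v` at the front of the queue and writes `u` at the back. Dominoes that copy letters
rotate the word, and all others act on the circular word as rewriting rules for the steps of the
machine. The queue can be emptied if and only if the machine halts (`matches_of_halts`,
`halts_of_matches`). If `Q` is the initial content and `W` the sequence of dominoes used, then
emptying the queue means that `Q` followed by the second halves of `W` is the concatenation of the
first halves of `W`. Since the end marker is always in the queue, and no domino other than the last
one of a computation has it before its last letter, nothing is read before it has been written as
long as the machine runs.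

**Words as numbers.** With nonzero digits, a word is determined by its value as a fraction in base
`B` (`wordValue_injective`), and appending a letter is an affine contraction of `[0, 1]`. So a
domino acts on the pair (all that has been written, all that has been read) by an affine
contraction of a pair of numbers `(x, y)`. In a probability vector `(x, y, z, w)` these two numbers
are stored in the first two coordinates, scaled by `1 / 32`, and `w` is the remaining mass. Three
kinds of stochastic matrices are used: `dominoMat` for a domino, `constMat` to reset `(x, y)` to
(value of the initial queue, `0`), and `testMat`, which moves the share `1 / 2 + (x - y) / 4` of the
mass to `z`. If the reset is followed by the dominoes of a match and then by the comparison, then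
`x = y` and the product is `targetMat`.

Conversely, a product that equals `targetMat` has to be of this form
(`targetMat_mem_closure_iff`). The mass in `z` never returns, so after a comparison, which moves at
least a quarter of the mass, a second comparison brings more than half of it to `z`, whereas a
domino or a reset makes `x` positive as long as any mass is left (`IsSpoiled`). Hence the comparison
is used once, at the end. Without a reset the product of the dominoes is an injective affine map,
and the comparison cannot give `1 / 2` for all initial vectors. With a reset, only the dominoes
after it matter, and `x = y` says that they form a match.

Only the reset depends on the input of the Turing machine. The machine is chosen so that its inputs
are the words `A z z ⋯ z`; then the entries of the reset are visibly primitive recursive.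
-/

namespace CPTPMembership

/-! ### Matching words by dominoes -/

/-- A word `Q` is matched by a set `D` of dominoes `(v, u)` if the word that starts with `Q` and
continues with the second halves of some sequence of dominoes from `D` is the concatenation of
their first halves. Thinking of `Q` as the content of a queue, a domino `(v, u)` reads `v` at the
front and writes `u` at the back, and a match empties the queue. -/
def Matches {α : Type*} (D : Set (List α × List α)) (Q : List α) : Prop :=
  ∃ W : List (List α × List α), (∀ p ∈ W, p ∈ D) ∧
    Q ++ (W.map Prod.snd).flatten = (W.map Prod.fst).flatten

theorem Matches.read_write {α : Type*} {D : Set (List α × List α)} {v u Q : List α}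
    (hD : (v, u) ∈ D) (h : Matches D (Q ++ u)) : Matches D (v ++ Q) := by
  obtain ⟨W, hW, e⟩ := h
  refine ⟨(v, u) :: W, List.forall_mem_cons.2 ⟨hD, hW⟩, ?_⟩
  simpa using e

/-- If all letters may be copied, then the queue may be rotated. -/
theorem Matches.rotate {α : Type*} {D : Set (List α × List α)} (hD : ∀ x, ([x], [x]) ∈ D)
    {A B : List α} (h : Matches D (B ++ A)) : Matches D (A ++ B) := by
  induction A generalizing B with
  | nil => simpa using h
  | cons x A ih => exact Matches.read_write (v := [x]) (hD x) (by
      simpa using ih (B := B ++ [x]) (by simpa using h))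

theorem isRotated_of_eq {α : Type*} {X Y A B : List α} (hX : X = A ++ B) (hY : Y = B ++ A) :
    X.IsRotated Y := by
  subst hX hY
  exact List.isRotated_append

/-- If `x` occurs only once in a circular word, then it determines where to cut the word. -/
theorem eq_append_of_cons_isRotated {α : Type*} {x : α} {Q A B : List α}
    (h : (x :: Q).IsRotated (A ++ x :: B)) (hA : x ∉ A) (hB : x ∉ B) : Q = B ++ A := by
  obtain ⟨n, hn⟩ := h
  have hn' : n % (x :: Q).length ≤ (x :: Q).length := (Nat.mod_lt _ (by simp)).le
  rw [← List.rotate_mod, List.rotate_eq_drop_append_take hn'] at hn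
  have hst := List.take_append_drop (n % (x :: Q).length) (x :: Q)
  generalize (x :: Q).take _ = s at hn hst
  generalize (x :: Q).drop _ = t at hn hst
  cases s with
  | nil =>
    cases A with
    | nil => simp_all
    | cons y A => simp_all
  | cons y s =>
    simp only [List.cons_append, List.cons.injEq] at hst
    obtain ⟨rfl, rfl⟩ := hst
    obtain ⟨rfl, -, rfl⟩ := (List.append_cons_inj_of_notMem hA hB).1 hn.symm
    rfl

/-- If `v` and `Q` are prefixes of the same word and `Q` contains a letter that can occur in `v`
only at the end, then `v` is a prefix of `Q`. -/
theorem split_of_append_eq {α : Type*} {x : α} {v Q X Y : List α} (hQ : x ∈ Q)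
    (hv : x ∉ v.dropLast) (h : Q ++ X = v ++ Y) : ∃ Q', Q = v ++ Q' ∧ Q' ++ X = Y := by
  rcases List.append_eq_append_iff.1 h with ⟨as, rfl, rfl⟩ | ⟨bs, rfl, rfl⟩
  · cases as with
    | nil => exact ⟨[], by simp⟩
    | cons a as => exact absurd (by simp [hQ]) hv
  · exact ⟨bs, rfl, rfl⟩

/-! ### Simulating a Turing machine by dominoes -/

open Turing

/-- The letters of the words that describe the configurations of a Turing machine with tape
symbols `Γ` and states `Λ`: besides symbols and states, an end marker and a letter that takes the
place of the state once the machine has halted. -/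
inductive Letter (Γ Λ : Type) : Type
  | sym (a : Γ)
  | state (q : Λ)
  | marker
  | halted

open Letter

instance (Γ Λ : Type) [Finite Γ] [Finite Λ] : Finite (Letter Γ Λ) :=
  Finite.of_injective (β := Option (Option (Γ ⊕ Λ)))
    (fun x => match x with
      | sym a => some (some (.inl a))
      | state q => some (some (.inr q))
      | marker => some none
      | halted => none)
    (by rintro (_ | _ | _ | _) (_ | _ | _ | _) h <;> simp_all)

section Simulation

variable {Γ Λ : Type}

section Dominoes

variable [Inhabited Γ] [Inhabited Λ] (M : TM0.Machine Γ Λ)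

/-- The dominoes of a Turing machine, first half read and second half written. On the circular
word `# l q r` they act as rewriting rules: letters may be copied, blanks may be inserted on either
side of the end marker, a step of the machine is carried out next to the state letter, and after
halting the tape is erased. The last domino empties a queue that holds only the halting letter and
the marker; it writes a letter and reads it again, because both halves of a domino have to be
nonempty for the encoding by stochastic matrices. -/
inductive IsDomino : List (Letter Γ Λ) → List (Letter Γ Λ) → Prop
  | copy (x : Letter Γ Λ) : IsDomino [x] [x]
  | padLeft : IsDomino [marker] [marker, sym default]
  | padRight : IsDomino [marker] [sym default, marker]
  | write {q q' : Λ} {a b : Γ} (h : M q a = some (q', .write b)) :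
      IsDomino [state q, sym a] [state q', sym b]
  | moveRight {q q' : Λ} {a : Γ} (h : M q a = some (q', .move .right)) :
      IsDomino [state q, sym a] [sym a, state q']
  | moveLeft {q q' : Λ} {a : Γ} (c : Γ) (h : M q a = some (q', .move .left)) :
      IsDomino [sym c, state q, sym a] [state q', sym c, sym a]
  | haltHere {q : Λ} {a : Γ} (h : M q a = none) : IsDomino [state q, sym a] [halted]
  | eraseRight (c : Γ) : IsDomino [halted, sym c] [halted]
  | eraseLeft (c : Γ) : IsDomino [sym c, halted] [halted]
  | finish : IsDomino [halted, marker, halted] [halted]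

/-- The set of dominoes of a Turing machine. -/
def dominoes : Set (List (Letter Γ Λ) × List (Letter Γ Λ)) :=
  {p | IsDomino M p.1 p.2}

theorem dominoes_ne_nil {p : List (Letter Γ Λ) × List (Letter Γ Λ)} (hp : p ∈ dominoes M) :
    p.1 ≠ [] ∧ p.2 ≠ [] := by
  rcases p with ⟨v, u⟩
  cases (hp : IsDomino M v u) <;> simp

theorem dominoes_finite [Finite Γ] [Finite Λ] : (dominoes M).Finite := by
  refine ((List.finite_length_le (Letter Γ Λ) 3).prod
    (List.finite_length_le (Letter Γ Λ) 3)).subset ?_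
  rintro ⟨v, u⟩ h
  cases (h : IsDomino M v u) <;> simp

end Dominoes

/-- The configuration in state `q` with `l` on the tape left of the head, and with `r` starting
at the head. -/
def config [Inhabited Γ] (l : List Γ) (q : Λ) (r : List Γ) : TM0.Cfg Γ Λ :=
  ⟨q, Tape.mk₂ l.reverse r⟩

/-- The word that describes a configuration. It is to be read circularly. -/
def configWord (l : List Γ) (q : Λ) (r : List Γ) : List (Letter Γ Λ) :=
  marker :: (l.map sym ++ state q :: r.map sym)

theorem eq_of_marker_isRotated {Q : List (Letter Γ Λ)} {l r : List Γ} {q : Λ}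
    (h : (marker :: Q).IsRotated (configWord l q r)) : Q = l.map sym ++ state q :: r.map sym := by
  simpa using eq_append_of_cons_isRotated (A := []) h (by simp) (by simp)

theorem eq_of_state_isRotated {Q : List (Letter Γ Λ)} {l r : List Γ} {q q' : Λ}
    (h : (state q' :: Q).IsRotated (configWord l q r)) :
    q' = q ∧ Q = r.map sym ++ marker :: l.map sym := by
  have hq : q' = q := by
    have := h.mem_iff.1 (List.mem_cons_self (a := state q') (l := Q))
    simpa [configWord] using this
  subst hq
  exact ⟨rfl, eq_append_of_cons_isRotated (A := marker :: l.map sym) h (by simp) (by simp)⟩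

section Blanks

variable [Inhabited Γ]

theorem listBlank_mk_append_default (l : List Γ) :
    ListBlank.mk (l ++ [default]) = ListBlank.mk l :=
  Quotient.sound (Or.inr ⟨1, rfl⟩)

theorem config_append_blank (l : List Γ) (q : Λ) (r : List Γ) :
    config l q (r ++ [default]) = config l q r := by
  simp [config, Tape.mk₂, listBlank_mk_append_default]

theorem config_cons_blank (l : List Γ) (q : Λ) (r : List Γ) :
    config (default :: l) q r = config l q r := by
  simp [config, Tape.mk₂, listBlank_mk_append_default]

end Blanks

variable [Inhabited Γ] [Inhabited Λ]

/-- The machine halts when started from a given configuration. -/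
def Halts (M : TM0.Machine Γ Λ) (c : TM0.Cfg Γ Λ) : Prop :=
  (StateTransition.eval (TM0.step M) c).Dom

variable {M : TM0.Machine Γ Λ}

theorem halts_of_step {c c' : TM0.Cfg Γ Λ} (h : TM0.step M c = some c') :
    Halts M c' → Halts M c := by
  intro h'
  rw [Halts, StateTransition.reaches_eval (Relation.ReflTransGen.single h)]
  exact h'

theorem step_write {q q' : Λ} {a b : Γ} (h : M q a = some (q', .write b)) (l r : List Γ) :
    TM0.step M (config l q (a :: r)) = some (config l q' (b :: r)) := by
  simp [TM0.step, config, Tape.mk₂, h, ← ListBlank.cons_mk, Tape.write_mk']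

theorem step_moveRight {q q' : Λ} {a : Γ} (h : M q a = some (q', .move .right))
    (l r : List Γ) :
    TM0.step M (config l q (a :: r)) = some (config (l ++ [a]) q' r) := by
  simp [TM0.step, config, Tape.mk₂, h, ← ListBlank.cons_mk]

theorem step_moveLeft {q q' : Λ} {a : Γ} (c : Γ) (h : M q a = some (q', .move .left))
    (l r : List Γ) :
    TM0.step M (config (l ++ [c]) q (a :: r)) = some (config l q' (c :: a :: r)) := by
  simp [TM0.step, config, Tape.mk₂, h, ← ListBlank.cons_mk]

theorem step_stop {q : Λ} {a : Γ} (h : M q a = none) (l r : List Γ) :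
    TM0.step M (config l q (a :: r)) = none := by
  simp [TM0.step, config, Tape.mk₂, h, ← ListBlank.cons_mk]

theorem halts_of_step_eq_none {c : TM0.Cfg Γ Λ} (h : TM0.step M c = none) : Halts M c :=
  Part.dom_iff_mem.2 ⟨c, StateTransition.mem_eval.2 ⟨.refl, h⟩⟩

/-- A domino acts on the circular words as a rewriting rule. -/
theorem Matches.rewrite {v u A B : List (Letter Γ Λ)} (hD : IsDomino M v u)
    (h : Matches (dominoes M) (A ++ u ++ B)) : Matches (dominoes M) (A ++ v ++ B) := by
  have hcopy : ∀ x : Letter Γ Λ, ([x], [x]) ∈ dominoes M := fun x => .copy x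
  rw [List.append_assoc]
  refine Matches.rotate hcopy ?_
  rw [List.append_assoc]
  refine Matches.read_write (u := u) hD ?_
  rw [List.append_assoc]
  refine Matches.rotate hcopy ?_
  exact h

/-- After halting, the tape can be erased and the queue can be emptied. -/
theorem matches_halted (l r : List Γ) :
    Matches (dominoes M) (marker :: (l.map sym ++ halted :: r.map sym)) := by
  induction r with
  | cons a r ih =>
    have := Matches.rewrite (A := marker :: l.map sym) (B := r.map sym) (.eraseRight a)
      (by simpa using ih)
    simpa using this
  | nil =>
    induction l using List.reverseRecOn with
    | nil =>
      refine Matches.rotate (A := [marker]) (B := [halted]) (fun x => .copy x) ?_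
      exact ⟨[([halted, marker, halted], [halted])], by simpa using .finish, by simp⟩
    | append_singleton l a ih =>
      have := Matches.rewrite (A := marker :: l.map sym) (B := []) (.eraseLeft a)
        (by simpa using ih)
      simpa using this

theorem Matches.of_append_blank {l r : List Γ} {q : Λ}
    (h : Matches (dominoes M) (configWord l q (r ++ [default]))) :
    Matches (dominoes M) (configWord l q r) := by
  have hcopy : ∀ x : Letter Γ Λ, ([x], [x]) ∈ dominoes M := fun x => .copy x
  refine Matches.read_write (v := [marker]) (u := [sym default, marker]) .padRight ?_
  have := Matches.rotate (A := l.map sym ++ state q :: (r ++ [default]).map sym) (B := [marker])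
    hcopy h
  simpa using this

theorem Matches.of_cons_blank {l r : List Γ} {q : Λ}
    (h : Matches (dominoes M) (configWord (default :: l) q r)) :
    Matches (dominoes M) (configWord l q r) := by
  exact Matches.rewrite (A := []) (v := [marker]) (B := l.map sym ++ state q :: r.map sym)
    .padLeft h

/-- If the machine halts, then its dominoes can imitate the computation and finally erase the
tape. -/
theorem matches_of_halts {l r : List Γ} {q : Λ} (h : Halts M (config l q r)) :
    Matches (dominoes M) (configWord l q r) := by
  obtain ⟨c, hc⟩ := Part.dom_iff_mem.1 h
  suffices ∀ x, c ∈ StateTransition.eval (TM0.step M) x → ∀ l q r, config l q r = x →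
      Matches (dominoes M) (configWord l q r) from this _ hc l q r rfl
  clear hc h l q r
  intro x hc
  refine StateTransition.evalInduction hc fun x _ ih l q r hx => ?_
  subst hx
  -- a blank is inserted on either side, so that the letters next to the state exist
  rw [← config_append_blank, ← config_cons_blank] at ih
  refine Matches.of_append_blank (Matches.of_cons_blank ?_)
  generalize hr : r ++ [default] = r' at ih ⊢
  generalize hl : default :: l = l' at ih ⊢
  obtain ⟨a, r, rfl⟩ := List.exists_cons_of_ne_nil (l := r') (by simp [← hr])
  obtain ⟨l, d, rfl⟩ := l'.eq_nil_or_concat'.resolve_left (by simp [← hl])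
  clear hr hl
  rcases e : M q a with _ | ⟨q', (_ | _) | b⟩
  · have := Matches.rewrite (A := marker :: (l ++ [d]).map sym) (B := r.map sym) (.haltHere e)
      (by simpa using matches_halted (M := M) (l ++ [d]) r)
    simpa [configWord] using this
  · have := Matches.rewrite (A := marker :: l.map sym) (B := r.map sym) (.moveLeft d e)
      (by simpa [configWord] using ih _ (step_moveLeft d e l r) _ _ _ rfl)
    simpa [configWord] using this
  · have := Matches.rewrite (A := marker :: (l ++ [d]).map sym) (B := r.map sym) (.moveRight e)
      (by simpa [configWord] using ih _ (step_moveRight e (l ++ [d]) r) _ _ _ rfl)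
    simpa [configWord] using this
  · have := Matches.rewrite (A := marker :: (l ++ [d]).map sym) (B := r.map sym) (.write e)
      (by simpa [configWord] using ih _ (step_write e (l ++ [d]) r) _ _ _ rfl)
    simpa [configWord] using this

/-- A queue that holds a configuration can only be emptied by dominoes that imitate the
computation until the machine halts. -/
theorem halts_of_matches {Q : List (Letter Γ Λ)} {l r : List Γ} {q : Λ}
    (hQ : Q.IsRotated (configWord l q r)) (h : Matches (dominoes M) Q) :
    Halts M (config l q r) := by
  obtain ⟨W, hW, e⟩ := h
  induction W generalizing Q l r q with
  | nil =>
    obtain rfl : Q = [] := by simpa using e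
    simpa [configWord] using hQ.perm.length_eq
  | cons p W ih =>
    obtain ⟨v, u⟩ := p
    obtain ⟨hp, hW⟩ := List.forall_mem_cons.1 hW
    replace ih := fun {Q} {l} {r} {q} hQ => @ih Q l r q hQ hW
    simp only [List.map_cons, List.flatten_cons] at e
    have hmarker : marker ∈ Q := hQ.mem_iff.2 (by simp [configWord])
    have hhalted : halted ∉ Q := fun h' => by simpa [configWord] using hQ.mem_iff.1 h'
    -- a domino cannot read beyond the end of the queue, which contains the marker
    have split : marker ∉ v.dropLast → ∃ Q', Q = v ++ Q' ∧
        (Q' ++ u) ++ (W.map Prod.snd).flatten = (W.map Prod.fst).flatten := by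
      intro hv
      obtain ⟨Q', h1, h2⟩ := split_of_append_eq hmarker hv e
      exact ⟨Q', h1, by simpa using h2⟩
    cases (hp : IsDomino M v u) with
    | copy x =>
      obtain ⟨Q', rfl, e'⟩ := split (by simp)
      exact ih ((List.isRotated_append (l := Q') (l' := [x])).trans hQ) e'
    | padLeft =>
      obtain ⟨Q', rfl, e'⟩ := split (by simp)
      obtain rfl := eq_of_marker_isRotated hQ
      rw [← config_cons_blank]
      refine ih ?_ e'
      exact isRotated_of_eq (A := l.map sym ++ state q :: r.map sym)
        (B := [marker, sym default]) (by simp) (by simp [configWord])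
    | padRight =>
      obtain ⟨Q', rfl, e'⟩ := split (by simp)
      obtain rfl := eq_of_marker_isRotated hQ
      rw [← config_append_blank]
      refine ih ?_ e'
      exact isRotated_of_eq (A := l.map sym ++ state q :: (r.map sym ++ [sym default]))
        (B := [marker]) (by simp) (by simp [configWord])
    | @write q₁ q' a b h =>
      obtain ⟨Q', rfl, e'⟩ := split (by simp)
      obtain ⟨rfl, hr⟩ := eq_of_state_isRotated (Q := sym a :: Q') hQ
      obtain _ | ⟨a', r⟩ := r
      · simp at hr
      simp only [List.map_cons, List.cons_append, List.cons.injEq, sym.injEq] at hr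
      obtain ⟨rfl, rfl⟩ := hr
      refine halts_of_step (step_write h l r) (ih ?_ e')
      exact isRotated_of_eq (A := r.map sym)
        (B := marker :: (l.map sym ++ [state q', sym b])) (by simp) (by simp [configWord])
    | @moveRight q₁ q' a h =>
      obtain ⟨Q', rfl, e'⟩ := split (by simp)
      obtain ⟨rfl, hr⟩ := eq_of_state_isRotated (Q := sym a :: Q') hQ
      obtain _ | ⟨a', r⟩ := r
      · simp at hr
      simp only [List.map_cons, List.cons_append, List.cons.injEq, sym.injEq] at hr
      obtain ⟨rfl, rfl⟩ := hr
      refine halts_of_step (step_moveRight h l r) (ih ?_ e')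
      exact isRotated_of_eq (A := r.map sym)
        (B := marker :: (l.map sym ++ [sym a, state q'])) (by simp) (by simp [configWord])
    | @moveLeft q₁ q' a c h =>
      obtain ⟨Q', rfl, e'⟩ := split (by simp)
      have hQ' : (state q₁ :: sym a :: (Q' ++ [sym c])).IsRotated (configWord l q r) :=
        (List.isRotated_append (l := state q₁ :: sym a :: Q') (l' := [sym c])).trans hQ
      obtain ⟨rfl, hr⟩ := eq_of_state_isRotated hQ'
      obtain _ | ⟨a', r⟩ := r
      · simp at hr
      simp only [List.map_cons, List.cons_append, List.cons.injEq, sym.injEq] at hr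
      obtain ⟨rfl, hr⟩ := hr
      obtain rfl | ⟨l, c', rfl⟩ := l.eq_nil_or_concat'
      · simpa using congrArg List.getLast? hr
      rw [List.map_append, List.map_singleton, ← List.cons_append, ← List.append_assoc] at hr
      obtain ⟨rfl, hc⟩ := List.append_inj' hr rfl
      obtain rfl : c = c' := by simpa using hc
      refine halts_of_step (step_moveLeft c h l r) (ih ?_ e')
      exact isRotated_of_eq (A := r.map sym)
        (B := marker :: (l.map sym ++ [state q', sym c, sym a])) (by simp) (by simp [configWord])
    | @haltHere q₁ a h =>
      obtain ⟨Q', rfl, e'⟩ := split (by simp)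
      obtain ⟨rfl, hr⟩ := eq_of_state_isRotated (Q := sym a :: Q') hQ
      obtain _ | ⟨a', r⟩ := r
      · simp at hr
      simp only [List.map_cons, List.cons_append, List.cons.injEq, sym.injEq] at hr
      obtain ⟨rfl, rfl⟩ := hr
      exact halts_of_step_eq_none (step_stop h l r)
    -- the halting letter does not occur in the word of a configuration
    | eraseRight c =>
      obtain ⟨Q', rfl, -⟩ := split (by simp)
      simp at hhalted
    | eraseLeft c =>
      obtain ⟨Q', rfl, -⟩ := split (by simp)
      simp at hhalted
    | finish =>
      cases Q with
      | nil => simp at hmarker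
      | cons x Q =>
        obtain ⟨rfl, -⟩ := by simpa using e
        simp at hhalted

end Simulation

/-! ### A Turing machine with an undecidable halting problem -/

theorem trNat_two_pow (n : ℕ) :
    PartrecToTM2.trNat (2 ^ n) =
      List.replicate n PartrecToTM2.Γ'.bit0 ++ [PartrecToTM2.Γ'.bit1] := by
  have key : ∀ n : ℕ, ∃ p : PosNum, (((2 ^ n : ℕ)) : Num) = .pos p ∧
      PartrecToTM2.trPosNum p =
        List.replicate n PartrecToTM2.Γ'.bit0 ++ [PartrecToTM2.Γ'.bit1] := by
    intro n
    induction n with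
    | zero => exact ⟨.one, by simp; rfl, rfl⟩
    | succ n ih =>
      obtain ⟨p, hp, hl⟩ := ih
      refine ⟨.bit0 p, ?_, by simp [PartrecToTM2.trPosNum, hl, List.replicate_succ]⟩
      rw [pow_succ, mul_two, Nat.cast_add, hp]
      exact congrArg Num.pos p.bit0_of_bit0
  obtain ⟨p, hp, hl⟩ := key n
  rw [PartrecToTM2.trNat, hp]
  exact hl

instance : Finite PartrecToTM2.K' :=
  Finite.of_injective (β := Fin 4)
    (fun k => match k with
      | .main => 0
      | .rev => 1
      | .aux => 2
      | .stack => 3)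
    (by rintro (_ | _ | _ | _) (_ | _ | _ | _) h <;> simp_all)

/-- Whether the `n`-th program halts on input `0`. -/
def HaltsAtZero (n : ℕ) : Prop :=
  (Nat.Partrec.Code.eval (Denumerable.ofNat Nat.Partrec.Code n) 0).Dom

theorem not_computable_haltsAtZero : ¬ ComputablePred HaltsAtZero := by
  intro h
  refine ComputablePred.halting_problem 0 ?_
  refine ComputablePred.computable_of_manyOneReducible
    (p := fun c => (Nat.Partrec.Code.eval c 0).Dom)
    ⟨Encodable.encode, Computable.encode, fun c => ?_⟩ h
  simp [HaltsAtZero]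

/-- Some list program halts on the input `2 ^ n` exactly if the `n`-th program halts on `0`. Powers
of two are used because their binary digits form a word that is easy to compute from `n`. -/
theorem exists_code_haltsAtZero :
    ∃ c : ToPartrec.Code, ∀ n, (c.eval [2 ^ n]).Dom ↔ HaltsAtZero n := by
  let lg : ℕ → ℕ := fun m => m.findGreatest fun k => 2 ^ k = m
  have hlg : Primrec lg :=
    Primrec.nat_findGreatest Primrec.id <| Primrec.eq.comp
      ((Primrec₂.unpaired'.1 Nat.Primrec.pow).comp (Primrec.const 2) Primrec.snd) Primrec.fst
  have lg_pow : ∀ n, lg (2 ^ n) = n := fun n => by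
    have := Nat.findGreatest_spec (P := fun k => 2 ^ k = 2 ^ n) (n := 2 ^ n)
      Nat.lt_two_pow_self.le rfl
    exact Nat.pow_right_injective le_rfl this
  let f : ℕ →. ℕ := fun m => Nat.Partrec.Code.eval (Denumerable.ofNat Nat.Partrec.Code (lg m)) 0
  have hf : Partrec f :=
    Nat.Partrec.Code.eval_part.comp ((Computable.ofNat _).comp hlg.to_comp) (Computable.const 0)
  obtain ⟨c, hc⟩ := ToPartrec.Code.exists_code (Nat.Partrec'.part_iff₁.2 hf)
  refine ⟨c, fun n => ?_⟩
  have := hc (2 ^ n ::ᵥ List.Vector.nil)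
  simp only [List.Vector.head_cons] at this
  have e : (2 ^ n ::ᵥ List.Vector.nil).1 = [2 ^ n] := rfl
  rw [e] at this
  rw [this, HaltsAtZero]
  simp [f, lg_pow]

/-- There is a Turing machine whose halting problem is undecidable already on the inputs
`A z z ⋯ z` with a fixed word `A` and a fixed symbol `z`. -/
theorem exists_machine :
    ∃ (Γ Λ : Type) (_ : Inhabited Γ) (_ : Inhabited Λ) (_ : Finite Γ) (_ : Finite Λ)
      (M : TM0.Machine Γ Λ) (A : List Γ) (z : Γ),
      ∀ n, (TM0.eval M (A ++ List.replicate n z)).Dom ↔ HaltsAtZero n := by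
  classical
  obtain ⟨c, hc⟩ := exists_code_haltsAtZero
  let _ : Inhabited PartrecToTM2.Λ' := ⟨PartrecToTM2.trNormal c .halt⟩
  let _ : Fintype PartrecToTM2.K' := Fintype.ofFinite _
  let M₁ := TM2to1.tr PartrecToTM2.tr
  let M₂ := TM1to0.tr M₁
  have hS := TM1to0.tr_supports M₁ (TM2to1.tr_supports _ (PartrecToTM2.tr_supports c .halt))
  generalize hS' : TM1to0.trStmts M₁ _ = S at hS
  -- the states are restricted to a finite set of accessible ones
  let Λ₂ : Type := (S : Set (TM1to0.Λ' M₁))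
  let _ : Inhabited Λ₂ := ⟨⟨default, hS.1⟩⟩
  let g : PointedMap (TM1to0.Λ' M₁) Λ₂ :=
    ⟨fun q => if h : q ∈ S then ⟨q, h⟩ else default, dif_pos hS.1⟩
  let cell : PartrecToTM2.Γ' → TM2to1.Γ' PartrecToTM2.K' fun _ => PartrecToTM2.Γ' := fun a =>
    (false, Function.update (fun _ => none) .main (some a))
  refine ⟨TM2to1.Γ' PartrecToTM2.K' fun _ => PartrecToTM2.Γ', Λ₂, inferInstance, inferInstance,
    inferInstance, inferInstance, M₂.map ⟨id, rfl⟩ ⟨id, rfl⟩ g Subtype.val,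
    TM2to1.trInit PartrecToTM2.K'.main [.bit1, .cons], cell .bit0, fun n => ?_⟩
  have h₁ : (TM2.eval PartrecToTM2.tr .main (PartrecToTM2.trList [2 ^ n])).Dom ↔
      (c.eval [2 ^ n]).Dom := by
    have := PartrecToTM2.tr_eval c [2 ^ n]
    have e : PartrecToTM2.init c [2 ^ n] =
        TM2.init PartrecToTM2.K'.main (PartrecToTM2.trList [2 ^ n]) := by
      simp only [PartrecToTM2.init, TM2.init]
      congr 1
      ext k : 1
      cases k <;> rfl
    rw [e] at this
    change (StateTransition.eval (TM2.step PartrecToTM2.tr) (TM2.init _ _)).Dom ↔ _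
    rw [this]
    rfl
  have h₂ : TM2to1.trInit PartrecToTM2.K'.main [.bit1, .cons] ++ List.replicate n (cell .bit0) =
      TM2to1.trInit PartrecToTM2.K'.main (PartrecToTM2.trList [2 ^ n]) := by
    have e : (PartrecToTM2.trList [2 ^ n]).reverse =
        .cons :: .bit1 :: List.replicate n .bit0 := by
      simp [trNat_two_pow]
    simp only [TM2to1.trInit, e]
    have hz : List.replicate n (cell .bit0) = (List.replicate n .bit0).map cell :=
      List.map_replicate.symm
    exact congrArg (fun t => _ :: _ :: t) hz
  rw [h₂]
  refine Iff.trans ?_ ((TM2to1.tr_eval_dom PartrecToTM2.tr .main _).trans (h₁.trans (hc n)))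
  rw [← TM1to0.tr_eval]
  refine StateTransition.tr_eval_dom (TM0.Machine.map_respects M₂ ⟨id, rfl⟩ ⟨id, rfl⟩ g
    Subtype.val (S := S) hS (fun _ => rfl) ?_) ⟨hS.1, ?_⟩
  · intro q hq
    exact congrArg Subtype.val (dif_pos hq)
  · exact (TM0.map_init ⟨id, rfl⟩ g _).trans (by simp)

/-- Matching words by a finite set of dominoes is undecidable already for the words `A z z ⋯ z`
with a fixed word `A` and a fixed letter `z`. -/
theorem exists_dominoes :
    ∃ (α : Type) (_ : Finite α) (D : Set (List α × List α)) (A : List α) (z : α),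
      D.Finite ∧ (∀ p ∈ D, p.1 ≠ [] ∧ p.2 ≠ []) ∧ A ≠ [] ∧
      ∀ n, Matches D (A ++ List.replicate n z) ↔ HaltsAtZero n := by
  obtain ⟨Γ, Λ, _, _, _, _, M, A, z, h⟩ := exists_machine
  refine ⟨Letter Γ Λ, inferInstance, dominoes M, configWord [] default A, .sym z,
    dominoes_finite M, fun p hp => dominoes_ne_nil M hp, by simp [configWord], fun n => ?_⟩
  have e : configWord [] default A ++ List.replicate n (.sym z) =
      configWord [] (default : Λ) (A ++ List.replicate n z) := by
    simp [configWord]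
  rw [← h n, e]
  change _ ↔ Halts M (config [] default (A ++ List.replicate n z))
  exact ⟨halts_of_matches (.refl _), matches_of_halts⟩

/-! ### Words as numbers -/

section WordValue

variable {α : Type*} (d : α → ℕ) (B : ℕ)

/-- The value of a word in base `B`, where the letter `a` stands for the digit `d a`. The last
letter of the word is the first digit after the point, so that appending a letter is a
contraction. -/
def wordValue (w : List α) : ℚ :=
  w.foldl (fun x a => (x + d a) / B) 0

variable {d B}

theorem wordValue_nil : wordValue d B ([] : List α) = 0 := rfl

theorem wordValue_concat (w : List α) (a : α) :
    wordValue d B (w ++ [a]) = (wordValue d B w + d a) / B := by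
  simp [wordValue]

theorem wordValue_append (w u : List α) :
    wordValue d B (w ++ u) = wordValue d B w / B ^ u.length + wordValue d B u := by
  induction u using List.reverseRecOn with
  | nil => simp [wordValue_nil]
  | append_singleton u a ih =>
    rw [← List.append_assoc, wordValue_concat, wordValue_concat, ih]
    simp only [List.length_append, List.length_singleton, pow_succ]
    rw [add_div, add_div, add_div, div_div]
    ring

theorem wordValue_nonneg (w : List α) : 0 ≤ wordValue d B w := by
  induction w using List.reverseRecOn with
  | nil => simp [wordValue_nil]
  | append_singleton u a ih =>
    rw [wordValue_concat]
    positivity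

theorem wordValue_lt_one (hB : ∀ a, d a < B) (w : List α) : wordValue d B w < 1 := by
  induction w using List.reverseRecOn with
  | nil => simp [wordValue_nil]
  | append_singleton u a ih =>
    have h1 : (d a : ℚ) + 1 ≤ B := by exact_mod_cast hB a
    have h2 : (0 : ℚ) ≤ d a := by positivity
    rw [wordValue_concat, div_lt_one (by linarith)]
    linarith

theorem wordValue_pos (h0 : ∀ a, 0 < d a) (hB : ∀ a, d a < B) {w : List α} (hw : w ≠ []) :
    0 < wordValue d B w := by
  obtain ⟨u, a, rfl⟩ := w.eq_nil_or_concat'.resolve_left hw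
  have h1 : (0 : ℚ) < d a := by exact_mod_cast h0 a
  have h2 : (d a : ℚ) < B := by exact_mod_cast hB a
  have := wordValue_nonneg (d := d) (B := B) u
  rw [wordValue_concat]
  exact div_pos (by linarith) (by linarith)

theorem wordValue_injective (hd : Function.Injective d) (h0 : ∀ a, 0 < d a)
    (hB : ∀ a, d a < B) : Function.Injective (wordValue d B) := by
  intro w
  induction w using List.reverseRecOn with
  | nil =>
    intro w' h
    by_contra hne
    exact (wordValue_pos h0 hB (Ne.symm hne)).ne h
  | append_singleton w a ih =>
    intro w' h
    obtain rfl | ⟨w', a', rfl⟩ := w'.eq_nil_or_concat'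
    · exact absurd h (wordValue_pos h0 hB (by simp)).ne'
    rw [wordValue_concat, wordValue_concat] at h
    have hB0 : (B : ℚ) ≠ 0 := by exact_mod_cast (Nat.zero_lt_of_lt (hB a)).ne'
    rw [div_left_inj' hB0] at h
    have b1 := wordValue_nonneg (d := d) (B := B) w
    have b2 := wordValue_nonneg (d := d) (B := B) w'
    have b3 := wordValue_lt_one hB w
    have b4 := wordValue_lt_one hB w'
    -- the values lie in `[0, 1)`, so the digits are the integral parts of both sides
    have ha : d a = d a' := by
      have h1 : (d a : ℚ) < d a' + 1 := by linarith
      have h2 : (d a' : ℚ) < d a + 1 := by linarith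
      norm_cast at h1 h2
      omega
    rw [ha, add_left_inj] at h
    rw [ih h, hd ha]

end WordValue

/-! ### Classical channels -/

section Channels

open scoped CStarAlgebra Matrix.Norms.L2Operator MatrixOrder

/-- A map in Kraus form is completely positive, because it acts on matrices over the matrices by
conjugation with block diagonal matrices. -/
theorem isCPTP_of_kraus {d : ℕ} {ι : Type*} [Fintype ι]
    {φ : Module.End ℂ (Matrix (Fin d) (Fin d) ℂ)} (K : ι → Matrix (Fin d) (Fin d) ℂ)
    (hφ : ∀ ρ, φ ρ = ∑ s, K s * ρ * star (K s))
    (htr : ∀ ρ, (φ ρ).trace = ρ.trace) : IsCPTP φ := by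
  refine ⟨⟨⟨φ, ?_⟩, rfl⟩, htr⟩
  intro k M hM
  let D : ι → CStarMatrix (Fin k) (Fin k) (Matrix (Fin d) (Fin d) ℂ) := fun s =>
    CStarMatrix.ofMatrix (Matrix.diagonal fun _ => K s)
  have h : (M.map φ : CStarMatrix (Fin k) (Fin k) (Matrix (Fin d) (Fin d) ℂ)) =
      ∑ s : ι, D s * M * star (D s) := by
    refine CStarMatrix.ext fun i j => ?_
    have hsum : ∀ (t : Finset ι) (f : ι → CStarMatrix (Fin k) (Fin k) (Matrix (Fin d) (Fin d) ℂ)),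
        (∑ s ∈ t, f s : CStarMatrix (Fin k) (Fin k) (Matrix (Fin d) (Fin d) ℂ)) i j =
          ∑ s ∈ t, f s i j := by
      classical
      intro t f
      induction t using Finset.induction_on with
      | empty => rfl
      | insert a t ha ih =>
        rw [Finset.sum_insert ha, Finset.sum_insert ha, CStarMatrix.add_apply, ih]
    refine (hφ (M i j)).trans (Eq.trans ?_ (hsum _ _).symm)
    refine Finset.sum_congr rfl fun s _ => ?_
    simp [D, CStarMatrix.mul_apply, CStarMatrix.star_apply, Matrix.diagonal_apply,
      apply_ite star]
  rw [h]
  exact Finset.sum_nonneg fun s _ => star_right_conjugate_nonneg hM _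

end Channels

/-- The channel that measures in the standard basis and then applies a stochastic matrix `P` (with
columns summing to `1`) to the resulting probability vector. -/
noncomputable def classicalMap {d : ℕ} (P : Matrix (Fin d) (Fin d) ℚ) :
    Module.End ℂ (Matrix (Fin d) (Fin d) ℂ) where
  toFun ρ := Matrix.diagonal fun k => ∑ i, (P k i : ℂ) * ρ i i
  map_add' ρ σ := by
    rw [Matrix.diagonal_add]
    simp [mul_add, Finset.sum_add_distrib]
  map_smul' r ρ := by
    rw [← Matrix.diagonal_smul]
    congr 1
    ext k
    simp only [Matrix.smul_apply, smul_eq_mul, RingHom.id_apply, Finset.mul_sum, Pi.smul_apply]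
    exact Finset.sum_congr rfl fun i _ => by ring

theorem classicalMap_apply {d : ℕ} (P : Matrix (Fin d) (Fin d) ℚ) (ρ : Matrix (Fin d) (Fin d) ℂ) :
    classicalMap P ρ = Matrix.diagonal fun k => ∑ i, (P k i : ℂ) * ρ i i := rfl

theorem classicalMap_mul {d : ℕ} (P Q : Matrix (Fin d) (Fin d) ℚ) :
    classicalMap P * classicalMap Q = classicalMap (P * Q) := by
  refine LinearMap.ext fun ρ => ?_
  rw [Module.End.mul_apply]
  simp only [classicalMap_apply, Matrix.diagonal_apply_eq, Matrix.mul_apply]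
  congr 1
  ext k
  simp only [Finset.mul_sum, Rat.cast_sum, Finset.sum_mul, Rat.cast_mul]
  rw [Finset.sum_comm]
  simp only [mul_assoc]

theorem classicalMap_injective {d : ℕ} :
    Function.Injective (classicalMap : Matrix (Fin d) (Fin d) ℚ → _) := by
  intro P Q h
  ext k i
  have := congrFun (congrFun (congrArg (fun φ => φ (Matrix.single i i 1)) h) k) k
  simpa [classicalMap_apply, Matrix.single_apply] using this

theorem classicalMap_ne_one {d : ℕ} [Nontrivial (Fin d)] (P : Matrix (Fin d) (Fin d) ℚ) :
    classicalMap P ≠ 1 := by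
  intro h
  obtain ⟨i, j, hij⟩ := exists_pair_ne (Fin d)
  have := congrFun (congrFun (congrArg (fun φ => φ (Matrix.single i j 1)) h) i) j
  simp [classicalMap_apply, Matrix.diagonal_apply_ne _ hij] at this

theorem isCPTP_one {d : ℕ} : IsCPTP (1 : Module.End ℂ (Matrix (Fin d) (Fin d) ℂ)) :=
  isCPTP_of_kraus (fun _ : Unit => 1) (by simp) (by simp)

theorem isCPTP_classicalMap {d : ℕ} {P : Matrix (Fin d) (Fin d) ℚ} (h0 : ∀ k i, 0 ≤ P k i)
    (h1 : ∀ i, ∑ k, P k i = 1) : IsCPTP (classicalMap P) := by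
  refine isCPTP_of_kraus
    (fun s : Fin d × Fin d => Matrix.single s.1 s.2 ((√(P s.1 s.2 : ℝ) : ℝ) : ℂ)) ?_ ?_
  · intro ρ
    ext k l
    simp only [classicalMap_apply, Matrix.sum_apply, Matrix.star_eq_conjTranspose,
      Matrix.conjTranspose_single, Fintype.sum_prod_type, Matrix.single_mul_mul_single]
    have hP : ∀ i, ((√(P k i : ℝ) : ℝ) : ℂ) * ρ i i * star ((√(P k i : ℝ) : ℝ) : ℂ) =
        (P k i : ℂ) * ρ i i := by
      intro i
      have h : (√(P k i : ℝ) : ℝ) * √(P k i : ℝ) = (P k i : ℝ) :=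
        Real.mul_self_sqrt (by exact_mod_cast h0 k i)
      rw [Complex.star_def, Complex.conj_ofReal, mul_right_comm, ← Complex.ofReal_mul, h]
      simp
    by_cases hkl : k = l
    · subst hkl
      rw [Matrix.diagonal_apply_eq]
      symm
      rw [Finset.sum_eq_single k]
      · simp only [Matrix.single_apply_same, hP]
      · intro x _ hx
        exact Finset.sum_eq_zero fun y _ => Matrix.single_apply_of_ne _ _ _ _ _ fun h => hx h.1
      · simp
    · rw [Matrix.diagonal_apply_ne _ hkl]
      refine (Finset.sum_eq_zero fun x _ => Finset.sum_eq_zero fun y _ => ?_).symm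
      exact Matrix.single_apply_of_ne _ _ _ _ _ fun h => hkl (h.1.symm.trans h.2)
  · intro ρ
    simp only [classicalMap_apply, Matrix.trace, Matrix.diag, Matrix.diagonal_apply_eq]
    rw [Finset.sum_comm]
    refine Finset.sum_congr rfl fun i _ => ?_
    rw [← Finset.sum_mul, ← Rat.cast_sum, h1 i, Rat.cast_one, one_mul]

/-! ### Codes -/

/-- The code of the linear map on the `4 × 4` matrices with given entries. -/
def entriesCode (g : Fin 4 → Fin 4 → Fin 4 → Fin 4 → GaussCode) : MapCode :=
  List.ofFn fun n : Fin 256 =>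
    g ⟨n / 64, by omega⟩ ⟨n / 16 % 4, by omega⟩ ⟨n / 4 % 4, by omega⟩ ⟨n % 4, by omega⟩

theorem entriesCode_length (g : Fin 4 → Fin 4 → Fin 4 → Fin 4 → GaussCode) :
    (entriesCode g).length = 4 ^ 4 := by
  rw [entriesCode, List.length_ofFn]
  norm_num

theorem entriesCode_coeff (g : Fin 4 → Fin 4 → Fin 4 → Fin 4 → GaussCode) (k l i j : Fin 4) :
    (entriesCode g).coeff ((((k : ℕ) * 4 + (l : ℕ)) * 4 + (i : ℕ)) * 4 + (j : ℕ)) =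
      (g k l i j).toComplex := by
  have hn : (((k : ℕ) * 4 + (l : ℕ)) * 4 + (i : ℕ)) * 4 + (j : ℕ) < 256 := by omega
  rw [MapCode.coeff, entriesCode, List.getD_eq_getElem _ _ (by rwa [List.length_ofFn]),
    List.getElem_ofFn]
  congr 2 <;> (apply Fin.ext; simp only; omega)

theorem GaussCode.toComplex_zero : GaussCode.toComplex (0, 0, 0) = 0 := by
  simp [GaussCode.toComplex]

theorem GaussCode.toComplex_one : GaussCode.toComplex (1, 0, 0) = 1 := by
  simp [GaussCode.toComplex]

/-- The code of the identity map on the `4 × 4` matrices. -/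
def oneCode : MapCode :=
  entriesCode fun k l i j => if k = i ∧ l = j then (1, 0, 0) else (0, 0, 0)

theorem toMap_oneCode : oneCode.toMap 4 = 1 := by
  refine LinearMap.ext fun ρ => ?_
  ext k l
  simp only [MapCode.toMap, LinearMap.coe_mk, AddHom.coe_mk, Matrix.of_apply, oneCode,
    entriesCode_coeff, Module.End.one_apply]
  simp [apply_ite GaussCode.toComplex, GaussCode.toComplex_zero, GaussCode.toComplex_one, ite_and]

/-- The code of a classical channel, from codes of the entries of the stochastic matrix. -/
def classicalCode (C : Fin 4 → Fin 4 → GaussCode) : MapCode :=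
  entriesCode fun k l i j => if k = l ∧ i = j then C k i else (0, 0, 0)

theorem toMap_classicalCode {C : Fin 4 → Fin 4 → GaussCode} {P : Matrix (Fin 4) (Fin 4) ℚ}
    (h : ∀ k i, (C k i).toComplex = P k i) : (classicalCode C).toMap 4 = classicalMap P := by
  refine LinearMap.ext fun ρ => ?_
  ext k l
  simp only [MapCode.toMap, LinearMap.coe_mk, AddHom.coe_mk, Matrix.of_apply, classicalCode,
    entriesCode_coeff, classicalMap_apply, Matrix.diagonal_apply]
  split_ifs with hkl <;>
    simp [apply_ite GaussCode.toComplex, GaussCode.toComplex_zero, h, hkl]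

/-- The code of a rational number. -/
def ratCode (q : ℚ) : GaussCode :=
  (q.num, 0, q.den - 1)

theorem toComplex_ratCode (q : ℚ) : (ratCode q).toComplex = q := by
  have h : ((q.den - 1 : ℕ) : ℂ) + 1 = (q.den : ℂ) := by
    exact_mod_cast Nat.sub_add_cancel q.den_pos
  simp only [GaussCode.toComplex, ratCode, Int.cast_zero, zero_mul, add_zero, h]
  exact (Rat.cast_def q).symm

/-! ### Stochastic matrices that simulate dominoes -/

/-- The stochastic matrix that acts on the probability vectors `(x, y, z, w)` with `z = 0` by
`x ↦ a * x + b` and `y ↦ c * y + e`, and that fixes the third basis vector. -/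
def pairMat (a b c e : ℚ) : Matrix (Fin 4) (Fin 4) ℚ :=
  !![a + b, b, 0, b; e, c + e, 0, e; 0, 0, 1, 0; 1 - a - b - e, 1 - b - c - e, 0, 1 - b - e]

/-- The stochastic matrix that resets the probability vectors `(x, y, z, w)` with `z = 0` to given
first coordinates, and that fixes the third basis vector. -/
def constMat (x y : ℚ) : Matrix (Fin 4) (Fin 4) ℚ :=
  !![x, x, 0, x; y, y, 0, y; 0, 0, 1, 0; 1 - x - y, 1 - x - y, 0, 1 - x - y]

/-- The stochastic matrix that compares the first two coordinates `x` and `y`: it moves the share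
`1 / 2 + (x - y) / 4` of a probability vector with `z = 0` to the third coordinate. -/
def testMat : Matrix (Fin 4) (Fin 4) ℚ :=
  !![0, 0, 0, 0; 0, 0, 0, 0; 3 / 4, 1 / 4, 1, 1 / 2; 1 / 4, 3 / 4, 0, 1 / 2]

/-- The result of comparing equal coordinates after a reset. -/
def targetMat : Matrix (Fin 4) (Fin 4) ℚ :=
  !![0, 0, 0, 0; 0, 0, 0, 0; 1 / 2, 1 / 2, 1, 1 / 2; 1 / 2, 1 / 2, 0, 1 / 2]

theorem pairMat_mul_pairMat (a b c e a' b' c' e' : ℚ) :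
    pairMat a b c e * pairMat a' b' c' e' =
      pairMat (a * a') (a * b' + b) (c * c') (c * e' + e) := by
  ext i j
  fin_cases i <;> fin_cases j <;>
    simp [pairMat, Matrix.mul_apply, Fin.sum_univ_four] <;> ring

theorem pairMat_mul_constMat (a b c e x y : ℚ) :
    pairMat a b c e * constMat x y = constMat (a * x + b) (c * y + e) := by
  ext i j
  fin_cases i <;> fin_cases j <;>
    simp [pairMat, constMat, Matrix.mul_apply, Fin.sum_univ_four] <;> ring

theorem constMat_mul_pairMat (x y a b c e : ℚ) :
    constMat x y * pairMat a b c e = constMat x y := by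
  ext i j
  fin_cases i <;> fin_cases j <;>
    simp [pairMat, constMat, Matrix.mul_apply, Fin.sum_univ_four] <;> ring

theorem constMat_mul_constMat (x y x' y' : ℚ) :
    constMat x y * constMat x' y' = constMat x y := by
  ext i j
  fin_cases i <;> fin_cases j <;>
    simp [constMat, Matrix.mul_apply, Fin.sum_univ_four] <;> ring

theorem testMat_mul_constMat (x : ℚ) : testMat * constMat x x = targetMat := by
  ext i j
  fin_cases i <;> fin_cases j <;>
    simp [testMat, constMat, targetMat, Matrix.mul_apply, Fin.sum_univ_four] <;> ring

theorem pairMat_eq_one : pairMat 1 0 1 0 = 1 := by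
  ext i j
  fin_cases i <;> fin_cases j <;> simp [pairMat]

theorem isCPTP_pairMat {a b c e : ℚ} (ha : 0 ≤ a) (ha' : a ≤ 1 / 2) (hb : 0 ≤ b)
    (hb' : b ≤ 1 / 32) (hc : 0 ≤ c) (hc' : c ≤ 1 / 2) (he : 0 ≤ e) (he' : e ≤ 1 / 32) :
    IsCPTP (classicalMap (pairMat a b c e)) := by
  refine isCPTP_classicalMap (fun k i => ?_) (fun i => ?_)
  · fin_cases k <;> fin_cases i <;> simp [pairMat] <;> linarith
  · fin_cases i <;> simp [pairMat, Fin.sum_univ_four] <;> ring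

theorem isCPTP_constMat {x y : ℚ} (hx : 0 ≤ x) (hy : 0 ≤ y) (hxy : x + y ≤ 1) :
    IsCPTP (classicalMap (constMat x y)) := by
  refine isCPTP_classicalMap (fun k i => ?_) (fun i => ?_)
  · fin_cases k <;> fin_cases i <;> simp [constMat] <;> linarith
  · fin_cases i <;> simp [constMat, Fin.sum_univ_four]

theorem isCPTP_testMat : IsCPTP (classicalMap testMat) := by
  refine isCPTP_classicalMap (fun k i => ?_) (fun i => ?_)
  · fin_cases k <;> fin_cases i <;> simp [testMat] <;> norm_num
  · fin_cases i <;> simp [testMat, Fin.sum_univ_four] <;> norm_num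

theorem isCPTP_targetMat : IsCPTP (classicalMap targetMat) := by
  refine isCPTP_classicalMap (fun k i => ?_) (fun i => ?_)
  · fin_cases k <;> fin_cases i <;> simp [targetMat]
  · fin_cases i <;> simp [targetMat, Fin.sum_univ_four] <;> norm_num

/-- The matrices of this kind are stochastic, have small first two coordinates and a large third
one in the image of the first basis vector. This holds for all products in which the comparison
has been carried out. -/
structure IsTested (P : Matrix (Fin 4) (Fin 4) ℚ) : Prop where
  x_nonneg : 0 ≤ P 0 0
  x_le : P 0 0 ≤ 1 / 16
  y_nonneg : 0 ≤ P 1 0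
  y_le : P 1 0 ≤ 1 / 16
  le_z : 1 / 4 ≤ P 2 0
  sum_le : P 0 0 + P 1 0 + P 2 0 ≤ 1
  w_eq : P 3 0 = 1 - P 0 0 - P 1 0 - P 2 0

/-- The products in which the comparison has been followed by a further generator. The last
condition distinguishes them from `targetMat`. -/
structure IsSpoiled (P : Matrix (Fin 4) (Fin 4) ℚ) : Prop extends IsTested P where
  spoiled : 1 / 2 < P 2 0 ∨ 0 < P 0 0

theorem IsTested.pairMat_mul {P : Matrix (Fin 4) (Fin 4) ℚ} (h : IsTested P) {a b c e : ℚ}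
    (ha : 0 ≤ a) (ha' : a ≤ 1 / 2) (hb : 0 < b) (hb' : b ≤ 1 / 32)
    (hc : 0 ≤ c) (hc' : c ≤ 1 / 2) (he : 0 ≤ e) (he' : e ≤ 1 / 32) :
    IsSpoiled (pairMat a b c e * P) := by
  obtain ⟨h1, h2, h3, h4, h5, h6, h7⟩ := h
  have e0 : (pairMat a b c e * P) 0 0 = a * P 0 0 + b * (1 - P 2 0) := by
    simp [pairMat, Matrix.mul_apply, Fin.sum_univ_four, h7]; ring
  have e1 : (pairMat a b c e * P) 1 0 = c * P 1 0 + e * (1 - P 2 0) := by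
    simp [pairMat, Matrix.mul_apply, Fin.sum_univ_four, h7]; ring
  have e2 : (pairMat a b c e * P) 2 0 = P 2 0 := by
    simp [pairMat, Matrix.mul_apply, Fin.sum_univ_four]
  have e3 : (pairMat a b c e * P) 3 0 = 1 - (a * P 0 0 + b * (1 - P 2 0)) -
      (c * P 1 0 + e * (1 - P 2 0)) - P 2 0 := by
    simp [pairMat, Matrix.mul_apply, Fin.sum_univ_four, h7]; ring
  have f1 : 0 ≤ a * P 0 0 := mul_nonneg ha h1
  have f2 : a * P 0 0 ≤ 1 / 2 * P 0 0 := mul_le_mul_of_nonneg_right ha' h1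
  have f3 : 0 ≤ c * P 1 0 := mul_nonneg hc h3
  have f4 : c * P 1 0 ≤ 1 / 2 * P 1 0 := mul_le_mul_of_nonneg_right hc' h3
  have hz : 0 ≤ 1 - P 2 0 := by linarith
  have f5 : 0 ≤ b * (1 - P 2 0) := mul_nonneg hb.le hz
  have f6 : b * (1 - P 2 0) ≤ 1 / 32 * (1 - P 2 0) := mul_le_mul_of_nonneg_right hb' hz
  have f7 : 0 ≤ e * (1 - P 2 0) := mul_nonneg he hz
  have f8 : e * (1 - P 2 0) ≤ 1 / 32 * (1 - P 2 0) := mul_le_mul_of_nonneg_right he' hz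
  refine ⟨⟨?_, ?_, ?_, ?_, ?_, ?_, ?_⟩, ?_⟩ <;> simp only [e0, e1, e2, e3]
  all_goals try linarith
  rcases lt_or_ge (1 / 2) (P 2 0) with hz' | hz'
  · exact .inl hz'
  · have := mul_pos hb (show 0 < 1 - P 2 0 by linarith)
    exact .inr (by linarith)

theorem IsTested.constMat_mul {P : Matrix (Fin 4) (Fin 4) ℚ} (h : IsTested P) {x : ℚ}
    (hx : 0 < x) (hx' : x ≤ 1 / 16) : IsSpoiled (constMat x 0 * P) := by
  obtain ⟨h1, h2, h3, h4, h5, h6, h7⟩ := h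
  have e0 : (constMat x 0 * P) 0 0 = x * (1 - P 2 0) := by
    simp [constMat, Matrix.mul_apply, Fin.sum_univ_four, h7]; ring
  have e1 : (constMat x 0 * P) 1 0 = 0 := by
    simp [constMat, Matrix.mul_apply, Fin.sum_univ_four]
  have e2 : (constMat x 0 * P) 2 0 = P 2 0 := by
    simp [constMat, Matrix.mul_apply, Fin.sum_univ_four]
  have e3 : (constMat x 0 * P) 3 0 = 1 - x * (1 - P 2 0) - 0 - P 2 0 := by
    simp [constMat, Matrix.mul_apply, Fin.sum_univ_four, h7]; ring
  have hz : 0 ≤ 1 - P 2 0 := by linarith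
  have f5 : 0 ≤ x * (1 - P 2 0) := mul_nonneg hx.le hz
  have f6 : x * (1 - P 2 0) ≤ 1 / 16 * (1 - P 2 0) := mul_le_mul_of_nonneg_right hx' hz
  refine ⟨⟨?_, ?_, ?_, ?_, ?_, ?_, ?_⟩, ?_⟩ <;> simp only [e0, e1, e2, e3]
  all_goals try linarith
  rcases lt_or_ge (1 / 2) (P 2 0) with hz' | hz'
  · exact .inl hz'
  · exact .inr (mul_pos hx (by linarith))

theorem testMat_mul_two_zero (P : Matrix (Fin 4) (Fin 4) ℚ) :
    (testMat * P) 2 0 = 3 / 4 * P 0 0 + 1 / 4 * P 1 0 + P 2 0 + 1 / 2 * P 3 0 := by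
  simp [testMat, Matrix.mul_apply, Fin.sum_univ_four]

theorem IsTested.testMat_mul {P : Matrix (Fin 4) (Fin 4) ℚ} (h : IsTested P) :
    IsSpoiled (testMat * P) := by
  obtain ⟨h1, h2, h3, h4, h5, h6, h7⟩ := h
  have e0 : (testMat * P) 0 0 = 0 := by simp [testMat, Matrix.mul_apply, Fin.sum_univ_four]
  have e1 : (testMat * P) 1 0 = 0 := by simp [testMat, Matrix.mul_apply, Fin.sum_univ_four]
  have e3 : (testMat * P) 3 0 = 1 / 4 * P 0 0 + 3 / 4 * P 1 0 + 1 / 2 * P 3 0 := by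
    simp [testMat, Matrix.mul_apply, Fin.sum_univ_four]
  refine ⟨⟨?_, ?_, ?_, ?_, ?_, ?_, ?_⟩, ?_⟩ <;>
    simp only [e0, e1, e3, testMat_mul_two_zero, h7]
  all_goals try linarith
  exact .inl (by linarith)

theorem isTested_testMat_mul {P : Matrix (Fin 4) (Fin 4) ℚ} (hx : 0 ≤ P 0 0) (hy : 0 ≤ P 1 0)
    (hz : P 2 0 = 0) (hx' : P 0 0 ≤ 1) (hy' : P 1 0 ≤ 1) (hw : P 3 0 = 1 - P 0 0 - P 1 0) :
    IsTested (testMat * P) := by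
  have e0 : (testMat * P) 0 0 = 0 := by simp [testMat, Matrix.mul_apply, Fin.sum_univ_four]
  have e1 : (testMat * P) 1 0 = 0 := by simp [testMat, Matrix.mul_apply, Fin.sum_univ_four]
  have e3 : (testMat * P) 3 0 = 1 / 4 * P 0 0 + 3 / 4 * P 1 0 + 1 / 2 * P 3 0 := by
    simp [testMat, Matrix.mul_apply, Fin.sum_univ_four]
  refine ⟨?_, ?_, ?_, ?_, ?_, ?_, ?_⟩ <;>
    simp only [e0, e1, e3, testMat_mul_two_zero, hz, hw] <;> linarith

/-! ### The generated semigroup -/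

section Semigroup

variable {α : Type*} (d : α → ℕ) (B : ℕ)

/-- The stochastic matrix of a domino: it appends the second half of the domino to the word held by
the first coordinate and the first half to the word held by the second coordinate. The scaling by
`1 / 32` leaves enough room for the columns of the matrix to be probability vectors. -/
def dominoMat (p : List α × List α) : Matrix (Fin 4) (Fin 4) ℚ :=
  pairMat (1 / B ^ p.2.length) (wordValue d B p.2 / 32)
    (1 / B ^ p.1.length) (wordValue d B p.1 / 32)

variable {d B}

theorem dominoMat_mul_constMat (p : List α × List α) (w w' : List α) :
    dominoMat d B p * constMat (wordValue d B w / 32) (wordValue d B w' / 32) =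
      constMat (wordValue d B (w ++ p.2) / 32) (wordValue d B (w' ++ p.1) / 32) := by
  rw [dominoMat, pairMat_mul_constMat, wordValue_append, wordValue_append]
  congr 1 <;> ring

theorem one_div_pow_le_half (hB : 2 ≤ B) {l : List α} (hl : l ≠ []) :
    (1 : ℚ) / B ^ l.length ≤ 1 / 2 := by
  have h : (2 : ℚ) ≤ B := by exact_mod_cast hB
  refine one_div_le_one_div_of_le two_pos (h.trans ?_)
  exact le_self_pow₀ (by linarith) (by simpa using hl)

/-- The generators: the identity, a reset that stores the word `w`, the comparison, and the
dominoes. -/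
def generatorSet (d : α → ℕ) (B : ℕ) (D : Set (List α × List α)) (w : List α) :
    Set (Module.End ℂ (Matrix (Fin 4) (Fin 4) ℂ)) :=
  {1, classicalMap (constMat (wordValue d B w / 32) 0), classicalMap testMat} ∪
    (fun p => classicalMap (dominoMat d B p)) '' D

theorem mem_generatorSet {D : Set (List α × List α)} {w : List α}
    {φ : Module.End ℂ (Matrix (Fin 4) (Fin 4) ℂ)} :
    φ ∈ generatorSet d B D w ↔
      (φ = 1 ∨ φ = classicalMap (constMat (wordValue d B w / 32) 0) ∨ φ = classicalMap testMat) ∨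
        ∃ p ∈ D, classicalMap (dominoMat d B p) = φ :=
  Iff.rfl

theorem isCPTP_reset (hB : ∀ a, d a < B) (w : List α) :
    IsCPTP (classicalMap (constMat (wordValue d B w / 32) 0)) := by
  have h1 := wordValue_nonneg (d := d) (B := B) w
  have h2 := wordValue_lt_one hB w
  exact isCPTP_constMat (by linarith) le_rfl (by linarith)

theorem isCPTP_dominoMat (hB2 : 2 ≤ B) (hB : ∀ a, d a < B) {p : List α × List α}
    (hp1 : p.1 ≠ []) (hp2 : p.2 ≠ []) : IsCPTP (classicalMap (dominoMat d B p)) := by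
  have b1 := wordValue_nonneg (d := d) (B := B) p.2
  have b2 := wordValue_lt_one hB p.2
  have e1 := wordValue_nonneg (d := d) (B := B) p.1
  have e2 := wordValue_lt_one hB p.1
  exact isCPTP_pairMat (by positivity) (one_div_pow_le_half hB2 hp2) (by linarith)
    (by linarith) (by positivity) (one_div_pow_le_half hB2 hp1) (by linarith) (by linarith)

/-- A class of matrices that contains those of all products of generators other than the identity:
products of dominoes, such products after a reset, both of these followed by a comparison, and
everything beyond. Of a product of dominoes without a reset, only the signs and bounds of its
coefficients are recorded. -/
inductive IsProduct (d : α → ℕ) (B : ℕ) (D : Set (List α × List α)) (w : List α) :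
    Matrix (Fin 4) (Fin 4) ℚ → Prop
  | pair {a b c e : ℚ} (ha : 0 < a) (hb : 0 ≤ b) (hab : a + b ≤ 1) (hc : 0 < c) (he : 0 ≤ e)
      (hce : c + e ≤ 1) : IsProduct d B D w (pairMat a b c e)
  | reset (W : List (List α × List α)) (hW : ∀ p ∈ W, p ∈ D) :
      IsProduct d B D w (constMat (wordValue d B (w ++ (W.map Prod.snd).flatten) / 32)
        (wordValue d B (W.map Prod.fst).flatten / 32))
  | testPair {a b c e : ℚ} (ha : 0 < a) (hb : 0 ≤ b) (hab : a + b ≤ 1) (hc : 0 < c)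
      (he : 0 ≤ e) (hce : c + e ≤ 1) : IsProduct d B D w (testMat * pairMat a b c e)
  | testReset (W : List (List α × List α)) (hW : ∀ p ∈ W, p ∈ D) :
      IsProduct d B D w (testMat * constMat (wordValue d B (w ++ (W.map Prod.snd).flatten) / 32)
        (wordValue d B (W.map Prod.fst).flatten / 32))
  | spoiled {P : Matrix (Fin 4) (Fin 4) ℚ} (h : IsSpoiled P) : IsProduct d B D w P

theorem isTested_testMat_mul_pairMat {a b c e : ℚ} (ha : 0 < a) (hb : 0 ≤ b) (hab : a + b ≤ 1)
    (hc : 0 < c) (he : 0 ≤ e) (hce : c + e ≤ 1) : IsTested (testMat * pairMat a b c e) := by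
  apply isTested_testMat_mul <;> simp [pairMat] <;> linarith

variable {D : Set (List α × List α)} {w : List α}

theorem isTested_testMat_mul_reset (hB : ∀ a, d a < B) (u v : List α) :
    IsTested (testMat * constMat (wordValue d B u / 32) (wordValue d B v / 32)) := by
  have h1 := wordValue_nonneg (d := d) (B := B) u
  have h2 := wordValue_nonneg (d := d) (B := B) v
  have h3 := wordValue_lt_one hB u
  have h4 := wordValue_lt_one hB v
  apply isTested_testMat_mul <;> simp [constMat] <;> linarith

theorem IsProduct.testMat_mul (hB : ∀ a, d a < B) {P : Matrix (Fin 4) (Fin 4) ℚ}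
    (h : IsProduct d B D w P) : IsProduct d B D w (testMat * P) := by
  cases h with
  | pair ha hb hab hc he hce => exact .testPair ha hb hab hc he hce
  | reset W hW => exact .testReset W hW
  | testPair ha hb hab hc he hce =>
    exact .spoiled (isTested_testMat_mul_pairMat ha hb hab hc he hce).testMat_mul
  | testReset W hW => exact .spoiled (isTested_testMat_mul_reset hB _ _).testMat_mul
  | spoiled h => exact .spoiled h.toIsTested.testMat_mul

theorem isProduct_constMat :
    IsProduct d B D w (constMat (wordValue d B w / 32) 0) := by
  simpa [wordValue_nil] using IsProduct.reset (d := d) (B := B) (D := D) (w := w) [] (by simp)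

theorem IsProduct.constMat_mul (h0 : ∀ a, 0 < d a) (hB : ∀ a, d a < B) (hw : w ≠ [])
    {P : Matrix (Fin 4) (Fin 4) ℚ} (h : IsProduct d B D w P) :
    IsProduct d B D w (constMat (wordValue d B w / 32) 0 * P) := by
  have h1 := wordValue_pos h0 hB hw
  have h2 := wordValue_lt_one hB w
  have key : ∀ {P}, IsTested P → IsProduct d B D w (constMat (wordValue d B w / 32) 0 * P) :=
    fun h => .spoiled (h.constMat_mul (by linarith) (by linarith))
  cases h with
  | pair ha hb hab hc he hce =>
    rw [constMat_mul_pairMat]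
    exact isProduct_constMat
  | reset W hW =>
    rw [constMat_mul_constMat]
    exact isProduct_constMat
  | testPair ha hb hab hc he hce => exact key (isTested_testMat_mul_pairMat ha hb hab hc he hce)
  | testReset W hW => exact key (isTested_testMat_mul_reset hB _ _)
  | spoiled h => exact key h.toIsTested

theorem two_le_of_digits (h0 : ∀ a, 0 < d a) (hB : ∀ a, d a < B) (hw : w ≠ []) : 2 ≤ B := by
  obtain ⟨a, _, rfl⟩ := List.exists_cons_of_ne_nil hw
  exact (Nat.succ_le_of_lt (h0 a)).trans_lt (hB a)

theorem IsProduct.dominoMat_mul (h0 : ∀ a, 0 < d a) (hB : ∀ a, d a < B)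
    {p : List α × List α} (hp : p ∈ D) (hp1 : p.1 ≠ []) (hp2 : p.2 ≠ [])
    {P : Matrix (Fin 4) (Fin 4) ℚ} (h : IsProduct d B D w P) :
    IsProduct d B D w (dominoMat d B p * P) := by
  have hB2 := two_le_of_digits h0 hB hp1
  have hB0 : (0 : ℚ) < B := by exact_mod_cast Nat.zero_lt_of_lt hB2
  have a1 : (0 : ℚ) < 1 / B ^ p.2.length := by positivity
  have a2 := one_div_pow_le_half hB2 hp2
  have c1 : (0 : ℚ) < 1 / B ^ p.1.length := by positivity
  have c2 := one_div_pow_le_half hB2 hp1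
  have b1 := wordValue_pos h0 hB hp2
  have b2 := wordValue_lt_one hB p.2
  have e1 := wordValue_pos h0 hB hp1
  have e2 := wordValue_lt_one hB p.1
  have key : ∀ {P}, IsTested P → IsProduct d B D w (dominoMat d B p * P) := fun h =>
    .spoiled (h.pairMat_mul a1.le a2 (by linarith) (by linarith) c1.le c2 (by linarith)
      (by linarith))
  cases h with
  | @pair a b c e ha hb hab hc he hce =>
    rw [dominoMat, pairMat_mul_pairMat]
    have k1 := mul_le_mul_of_nonneg_left hab a1.le
    have k2 := mul_le_mul_of_nonneg_left hce c1.le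
    have k3 := mul_nonneg a1.le hb
    have k4 := mul_nonneg c1.le he
    exact .pair (mul_pos a1 ha) (by linarith) (by linarith) (mul_pos c1 hc) (by linarith)
      (by linarith)
  | reset W hW =>
    rw [dominoMat_mul_constMat]
    have := IsProduct.reset (d := d) (B := B) (w := w) (W ++ [p]) (D := D) (by
      intro q hq
      rcases List.mem_append.1 hq with hq | hq
      · exact hW q hq
      · rwa [List.mem_singleton.1 hq])
    simpa using this
  | testPair ha hb hab hc he hce => exact key (isTested_testMat_mul_pairMat ha hb hab hc he hce)
  | testReset W hW => exact key (isTested_testMat_mul_reset hB _ _)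
  | spoiled h => exact key h.toIsTested

/-- The target arises only by a comparison after a reset, and then the dominoes form a match. -/
theorem matches_of_isProduct_targetMat (hd : Function.Injective d) (h0 : ∀ a, 0 < d a)
    (hB : ∀ a, d a < B) (h : IsProduct d B D w targetMat) : Matches D w := by
  generalize hP : targetMat = P at h
  cases h with
  | pair =>
    have := congrFun (congrFun hP 2) 0
    simp [targetMat, pairMat] at this
  | reset =>
    have := congrFun (congrFun hP 2) 0
    simp [targetMat, constMat] at this
  | testPair ha hb hab hc he hce =>
    -- the columns would give `a + b = e` and `b = c + e`
    have h1 := congrFun (congrFun hP 2) 0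
    have h2 := congrFun (congrFun hP 2) 1
    simp [targetMat, testMat, pairMat, Matrix.mul_apply, Fin.sum_univ_four] at h1 h2
    linarith
  | testReset W hW =>
    refine ⟨W, hW, wordValue_injective hd h0 hB ?_⟩
    have h1 := congrFun (congrFun hP 2) 0
    simp [targetMat, testMat, constMat, Matrix.mul_apply, Fin.sum_univ_four] at h1
    linarith
  | spoiled h =>
    subst hP
    have := h.spoiled
    simp [targetMat] at this

theorem eq_one_or_isProduct (h0 : ∀ a, 0 < d a) (hB : ∀ a, d a < B) (hw : w ≠ [])
    (hD : ∀ p ∈ D, p.1 ≠ [] ∧ p.2 ≠ []) {φ : Module.End ℂ (Matrix (Fin 4) (Fin 4) ℂ)}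
    (hφ : φ ∈ Subsemigroup.closure (generatorSet d B D w)) :
    φ = 1 ∨ ∃ P, IsProduct d B D w P ∧ φ = classicalMap P := by
  have hφ' : φ ∈ Submonoid.closure (generatorSet d B D w) := by
    have : Subsemigroup.closure (generatorSet d B D w) ≤
        (Submonoid.closure (generatorSet d B D w)).toSubsemigroup :=
      Subsemigroup.closure_le.2 Submonoid.subset_closure
    exact this hφ
  clear hφ
  have hone : IsProduct d B D w 1 := by
    rw [← pairMat_eq_one]
    exact .pair one_pos le_rfl (by norm_num) one_pos le_rfl (by norm_num)
  have step : ∀ {G : Matrix (Fin 4) (Fin 4) ℚ} {φ : Module.End ℂ (Matrix (Fin 4) (Fin 4) ℂ)},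
      (∀ {P}, IsProduct d B D w P → IsProduct d B D w (G * P)) →
      (φ = 1 ∨ ∃ P, IsProduct d B D w P ∧ φ = classicalMap P) →
      ∃ P, IsProduct d B D w P ∧ classicalMap G * φ = classicalMap P := by
    rintro G _ hG (rfl | ⟨P, hP, rfl⟩)
    · exact ⟨G, by simpa using hG hone, mul_one _⟩
    · exact ⟨G * P, hG hP, classicalMap_mul G P⟩
  induction hφ' using Submonoid.closure_induction_left with
  | one => exact .inl rfl
  | mul_left g hg φ _ ih =>
    rcases hg with (rfl | rfl | rfl) | ⟨p, hp, rfl⟩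
    · rwa [one_mul]
    · exact .inr (step (.constMat_mul h0 hB hw) ih)
    · exact .inr (step (.testMat_mul hB) ih)
    · exact .inr (step (.dominoMat_mul h0 hB hp (hD p hp).1 (hD p hp).2) ih)

/-- The comparison after a reset lies in the semigroup exactly if the stored word is matched. -/
theorem targetMat_mem_closure_iff (hd : Function.Injective d) (h0 : ∀ a, 0 < d a)
    (hB : ∀ a, d a < B) (hw : w ≠ []) (hD : ∀ p ∈ D, p.1 ≠ [] ∧ p.2 ≠ []) :
    classicalMap targetMat ∈ Subsemigroup.closure (generatorSet d B D w) ↔ Matches D w := by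
  constructor
  · intro h
    rcases eq_one_or_isProduct h0 hB hw hD h with h | ⟨P, hP, h⟩
    · exact absurd h (classicalMap_ne_one _)
    · rw [← classicalMap_injective h] at hP
      exact matches_of_isProduct_targetMat hd h0 hB hP
  · rintro ⟨W, hW, e⟩
    have key : ∀ W : List (List α × List α), (∀ p ∈ W, p ∈ D) →
        classicalMap (constMat (wordValue d B (w ++ (W.map Prod.snd).flatten) / 32)
          (wordValue d B (W.map Prod.fst).flatten / 32)) ∈
            Subsemigroup.closure (generatorSet d B D w) := by
      intro W
      induction W using List.reverseRecOn with
      | nil =>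
        intro _
        exact Subsemigroup.subset_closure (by simp [generatorSet, wordValue_nil])
      | append_singleton W p ih =>
        intro hW
        have h1 := ih fun q hq => hW q (by simp [hq])
        have h2 : classicalMap (dominoMat d B p) ∈
            Subsemigroup.closure (generatorSet d B D w) :=
          Subsemigroup.subset_closure (.inr ⟨p, hW p (by simp), rfl⟩)
        have := mul_mem h2 h1
        rw [classicalMap_mul, dominoMat_mul_constMat] at this
        simpa using this
    have h1 := key W hW
    have h2 : classicalMap testMat ∈ Subsemigroup.closure (generatorSet d B D w) :=
      Subsemigroup.subset_closure (by simp [generatorSet])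
    have := mul_mem h2 h1
    rwa [classicalMap_mul, e, testMat_mul_constMat] at this

end Semigroup

/-! ### The reduction -/

theorem primrec_natCast_int : Primrec fun n : ℕ => (n : ℤ) := by
  rw [← Primrec.encode_iff]
  have h : Primrec fun n : ℕ => 2 * n := Primrec.nat_mul.comp (Primrec.const 2) Primrec.id
  -- a natural number is encoded as an integer by its double
  exact h.of_eq fun n => by rfl

/-- The entries of `constMat x 0`, given codes for `x` and `1 - x`. -/
def resetEntries (s t : GaussCode) : Fin 4 → Fin 4 → GaussCode := fun k i =>
  if i = 2 then (if k = 2 then (1, 0, 0) else (0, 0, 0))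
  else if k = 0 then s else if k = 3 then t else (0, 0, 0)

theorem primrec_classicalCode_resetEntries {s t : ℕ → GaussCode} (hs : Primrec s)
    (ht : Primrec t) : Primrec fun n => classicalCode (resetEntries (s n) (t n)) := by
  refine Primrec.list_ofFn fun i => ?_
  unfold resetEntries
  split_ifs <;> first | exact hs | exact ht | exact Primrec.const _

theorem toMap_resetEntries {s t : GaussCode} {x : ℚ} (hs : s.toComplex = x)
    (ht : t.toComplex = ((1 - x : ℚ) : ℂ)) :
    (classicalCode (resetEntries s t)).toMap 4 = classicalMap (constMat x 0) := by
  refine toMap_classicalCode fun k i => ?_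
  fin_cases k <;> fin_cases i <;>
    simp [resetEntries, constMat, hs, ht, GaussCode.toComplex_zero, GaussCode.toComplex_one]

theorem exists_classicalCode (P : Matrix (Fin 4) (Fin 4) ℚ) :
    ∃ c : MapCode, c.length = 4 ^ 4 ∧ c.toMap 4 = classicalMap P :=
  ⟨classicalCode fun k i => ratCode (P k i), entriesCode_length _,
    toMap_classicalCode fun _ _ => toComplex_ratCode _⟩

theorem exists_oneCode : ∃ c : MapCode, c.length = 4 ^ 4 ∧ c.toMap 4 = 1 :=
  ⟨oneCode, entriesCode_length _, toMap_oneCode⟩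

/-- The value of `A z z ⋯ z` is a fraction whose numerator and denominator are primitive recursive
in the number of letters `z`. -/
theorem exists_primrec_wordValue {α : Type} (d : α → ℕ) {B : ℕ} (hB : 0 < B) (A : List α) (z : α) :
    ∃ f : ℕ → ℕ × ℕ, Primrec f ∧ ∀ n, 0 < (f n).2 ∧
      wordValue d B (A ++ List.replicate n z) = (f n).1 / (f n).2 := by
  let step : ℕ → ℕ × ℕ → ℕ × ℕ := fun _ p => (p.1 + d z * p.2, p.2 * B)
  have hstep : Primrec₂ step := by
    have h1 : Primrec fun x : ℕ × ℕ × ℕ => x.2.1 := Primrec.fst.comp Primrec.snd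
    have h2 : Primrec fun x : ℕ × ℕ × ℕ => x.2.2 := Primrec.snd.comp Primrec.snd
    exact Primrec.pair
      (Primrec.nat_add.comp h1 (Primrec.nat_mul.comp (Primrec.const (d z)) h2))
      (Primrec.nat_mul.comp h2 (Primrec.const B))
  let q := wordValue d B A
  let f : ℕ → ℕ × ℕ := Nat.rec (q.num.toNat, q.den) step
  have hf : Primrec f := Primrec.nat_rec₁ _ hstep
  have f_zero : f 0 = (q.num.toNat, q.den) := rfl
  have f_succ : ∀ n, f (n + 1) = ((f n).1 + d z * (f n).2, (f n).2 * B) := fun _ => rfl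
  clear_value f
  refine ⟨f, hf, fun n => ?_⟩
  induction n with
  | zero =>
    rw [f_zero]
    refine ⟨q.den_pos, ?_⟩
    have h : ((q.num.toNat : ℤ) : ℚ) = q.num := by
      rw [Int.toNat_of_nonneg (Rat.num_nonneg.2 (wordValue_nonneg A))]
    simp only [List.replicate_zero, List.append_nil]
    rw [← Int.cast_natCast q.num.toNat, h, Rat.num_div_den]
  | succ n ih =>
    obtain ⟨h1, h2⟩ := ih
    rw [f_succ]
    refine ⟨Nat.mul_pos h1 hB, ?_⟩
    rw [List.replicate_succ', ← List.append_assoc, wordValue_concat, h2]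
    have hp : ((f n).2 : ℚ) ≠ 0 := by exact_mod_cast h1.ne'
    have hB' : (B : ℚ) ≠ 0 := by exact_mod_cast hB.ne'
    push_cast
    field_simp

theorem toComplex_natCode (a : ℕ) {b : ℕ} (hb : 0 < b) :
    GaussCode.toComplex ((a : ℤ), 0, b - 1) = ((a / b : ℚ) : ℂ) := by
  have h : ((b - 1 : ℕ) : ℂ) + 1 = (b : ℂ) := by
    exact_mod_cast Nat.sub_add_cancel hb
  simp [GaussCode.toComplex, h]

/-- The codes of the resets are primitive recursive in the length of the stored word. -/
theorem exists_primrec_resetCode {α : Type} {d : α → ℕ} {B : ℕ} (hB : ∀ a, d a < B)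
    (A : List α) (z : α) :
    ∃ c : ℕ → MapCode, Primrec c ∧ ∀ n, (c n).length = 4 ^ 4 ∧
      (c n).toMap 4 =
        classicalMap (constMat (wordValue d B (A ++ List.replicate n z) / 32) 0) := by
  obtain ⟨f, hf, hfn⟩ := exists_primrec_wordValue d (Nat.zero_lt_of_lt (hB z)) A z
  let s : ℕ → GaussCode := fun n => (((f n).1 : ℤ), 0, 32 * (f n).2 - 1)
  let t : ℕ → GaussCode := fun n => (((32 * (f n).2 - (f n).1 : ℕ) : ℤ), 0, 32 * (f n).2 - 1)
  have hden : Primrec fun n => 32 * (f n).2 :=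
    Primrec.nat_mul.comp (Primrec.const 32) (Primrec.snd.comp hf)
  have hs : Primrec s := (primrec_natCast_int.comp (Primrec.fst.comp hf)).pair
    ((Primrec.const 0).pair (Primrec.nat_sub.comp hden (Primrec.const 1)))
  have ht : Primrec t :=
    (primrec_natCast_int.comp (Primrec.nat_sub.comp hden (Primrec.fst.comp hf))).pair
      ((Primrec.const 0).pair (Primrec.nat_sub.comp hden (Primrec.const 1)))
  refine ⟨_, primrec_classicalCode_resetEntries hs ht, fun n => ⟨entriesCode_length _, ?_⟩⟩
  obtain ⟨h1, h2⟩ := hfn n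
  have hpos : 0 < 32 * (f n).2 := by omega
  have hx : wordValue d B (A ++ List.replicate n z) / 32 =
      (((f n).1 : ℚ) / (32 * (f n).2 : ℕ)) := by
    rw [h2]
    push_cast
    rw [div_div, mul_comm]
  have hle : (f n).1 ≤ 32 * (f n).2 := by
    have h3 := wordValue_lt_one hB (A ++ List.replicate n z)
    rw [h2, div_lt_one (by exact_mod_cast h1)] at h3
    have h4 : (f n).1 < (f n).2 := by exact_mod_cast h3
    omega
  rw [hx]
  refine toMap_resetEntries (toComplex_natCode _ hpos) ?_
  have h5 : ((32 * (f n).2 : ℕ) : ℚ) ≠ 0 := by exact_mod_cast hpos.ne'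
  rw [one_sub_div h5, ← Nat.cast_sub hle]
  exact toComplex_natCode _ hpos

/-- The halting problem reduces to the membership problem for classical channels in dimension `4`
together with the identity. -/
theorem exists_reduction :
    ∃ g : ℕ → MembershipInput, Computable g ∧ ∀ n, (g n).Valid ∧ (g n).dim = 4 ∧
      1 ∈ (g n).generators ∧ ((g n).IsYes ↔ HaltsAtZero n) := by
  obtain ⟨α, _, D, A, z, hfin, hD, hA, hmatch⟩ := exists_dominoes
  let ε := Finite.equivFin α
  let d : α → ℕ := fun a => ε a + 1
  let B : ℕ := Nat.card α + 1
  have hd : Function.Injective d := fun a b h => ε.injective (Fin.ext (Nat.succ_injective h))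
  have h0 : ∀ a, 0 < d a := fun a => Nat.succ_pos _
  have hB : ∀ a, d a < B := fun a => Nat.succ_lt_succ (ε a).2
  let w : ℕ → List α := fun n => A ++ List.replicate n z
  have hw : ∀ n, w n ≠ [] := fun n => by simp [w, hA]
  obtain ⟨reset, hreset, hreset'⟩ := exists_primrec_resetCode hB A z
  obtain ⟨one, hone, hone'⟩ := exists_oneCode
  choose code hcode hcode' using exists_classicalCode
  let rest : List MapCode :=
    one :: code testMat :: hfin.toFinset.toList.map fun p => code (dominoMat d B p)
  let g : ℕ → MembershipInput := fun n => (4, reset n :: rest, code targetMat)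
  have hgen : ∀ n, (g n).generators = generatorSet d B D (w n) := by
    intro n
    ext φ
    change (∃ c ∈ reset n :: rest, MapCode.toMap 4 c = φ) ↔ φ ∈ generatorSet d B D (w n)
    refine Iff.trans ?_ mem_generatorSet.symm
    simp only [rest, List.mem_cons, List.mem_map, Finset.mem_toList, Set.Finite.mem_toFinset,
      exists_eq_or_imp, (hreset' n).2, hone', hcode', exists_exists_and_eq_and, w]
    tauto
  refine ⟨g, ?_, fun n => ⟨⟨Nat.succ_pos _, ?_, hcode _, ?_⟩, rfl, ?_, ?_⟩⟩
  · exact ((Primrec.const 4).pair ((Primrec.list_cons.comp hreset (Primrec.const rest)).pair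
      (Primrec.const _))).to_comp
  · change ∀ c ∈ reset n :: rest, MapCode.Valid 4 c
    simp only [rest, List.forall_mem_cons, List.forall_mem_map, Finset.mem_toList,
      Set.Finite.mem_toFinset, MapCode.Valid, hcode, hcode', hone, hone', hreset', true_and]
    exact ⟨isCPTP_reset hB _, isCPTP_one, isCPTP_testMat, fun p hp =>
      isCPTP_dominoMat (two_le_of_digits h0 hB hA) hB (hD p hp).1 (hD p hp).2⟩
  · change IsCPTP ((code targetMat).toMap 4)
    rw [hcode']
    exact isCPTP_targetMat
  · rw [hgen]
    exact .inl (.inl rfl)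
  · rw [← hmatch n, ← targetMat_mem_closure_iff hd h0 hB (hw n) hD, ← hgen n, ← hcode']
    exact Iff.rfl

end CPTPMembership

/-- The membership problem for semigroups of CPTP maps is undecidable, and it stays so when the maps
act on the `4 × 4` matrices and the generating set contains the identity map. -/
theorem theorem1 :
    ¬ CPTPMembership.DecidableOn {x | x.Valid} ∧
    ¬ CPTPMembership.DecidableOn {x | x.Valid ∧ x.dim = 4 ∧ 1 ∈ x.generators} := by
  have key : ¬ CPTPMembership.DecidableOn {x | x.Valid ∧ x.dim = 4 ∧ 1 ∈ x.generators} := by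
    rintro ⟨A, hA, h⟩
    obtain ⟨g, hg, hgn⟩ := CPTPMembership.exists_reduction
    refine CPTPMembership.not_computable_haltsAtZero ⟨fun _ => Classical.propDecidable _, ?_⟩
    refine (hA.comp hg).of_eq fun n => ?_
    obtain ⟨hv, hdim, hone, hyes⟩ := hgn n
    obtain ⟨b, hb, hiff⟩ := h (g n) ⟨hv, hdim, hone⟩
    rw [hb]
    refine congrArg Part.some ?_
    rw [Bool.eq_iff_iff]
    exact hiff.trans (hyes.trans (@decide_eq_true_iff _ (Classical.propDecidable _)).symm)
  exact ⟨fun ⟨A, hA, h⟩ => key ⟨A, hA, fun x hx => h x hx.1⟩, key⟩
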